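/- Let $\mathbb{F}_q$ be a finite field with $q$ odd and $q\ge 13$, and let $k$ be an integer with $3\le k\le \frac{q-1}{2}-2$. For an integer $n>k$, pairwise distinct $\alpha_1,\dots,\alpha_n\in\mathbb{F}_q$ and $\eta\in\mathbb{F}_q$, the twisted Reed--Solomon code with one twist $t=1$ and hook $h=0$ is $$\mathcal{C}^{n,k}_{\alpha,1,0,\eta}=\Big\{\big(f(\alpha_1),\dots,f(\alpha_n)\big) : f=\sum_{i=0}^{k-1}f_iX^i+\eta f_0X^{k},\ f_0,\dots,f_{k-1}\in\mathbb{F}_q\Big\}\subseteq\mathbb{F}_q^n .$$ A linear code of length $n$, dimension $k$ and minimum Hamming distance $d$ is MDS if $d=n-k+1$. The code $\mathcal{C}^{n,k}_{\alpha,1,0,\eta}$ is called $(*)$-twisted if there is a proper subgroup $G$ of $(\mathbb{F}_q^*,\cdot)$ such that $\alpha_i\in G\cup\{0\}$ for all $i$, $\eta\neq0$, and $(-1)^k\eta^{-1}\in\mathbb{F}_q^*\setminus G$. 1. If $n>\frac{q+1}{2}$, then $\mathcal{C}^{n,k}_{\alpha,1,0,\eta}$ is not MDS, for any choice of pairwise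 distinct $\alpha_1,\dots,\alpha_n\in\mathbb{F}_q$ and any $\eta\in\mathbb{F}_q\setminus\{0\}$. 2. There is a $(*)$-twisted code of length $\frac{q+1}{2}$ and dimension $k$ that is MDS. Hence $\frac{q+1}{2}$ is the maximal length of an MDS twisted Reed--Solomon code of dimension $k$ with one twist $t=1$, hook $h=0$ and $\eta\ne0$, and it is attained by a $(*)$-twisted code. -/

import Mathlib

open Polynomial

noncomputable section

/-- The minimum distance of a code: the least Hamming distance between two distinct codewords. -/
def minDist {F : Type*} [Field F] [DecidableEq F] {n : ℕ} (C : Submodule F (Fin n → F)) : ℕ :=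
  sInf {d : ℕ | ∃ x ∈ C, ∃ y ∈ C, x ≠ y ∧ hammingDist x y = d}

/-- A linear code of length `n` is MDS if its minimum distance `d` and dimension `k`
meet the Singleton bound, `d = n - k + 1`; this is written without subtraction. -/
def IsMDS {F : Type*} [Field F] [DecidableEq F] {n : ℕ} (C : Submodule F (Fin n → F)) : Prop :=
  minDist C + Module.finrank F C = n + 1

/-- The evaluation map `f ↦ [f(α₁), …, f(αₙ)]`. -/
def evalMap {F : Type*} [Field F] {n : ℕ} (α : Fin n → F) : F[X] →ₗ[F] (Fin n → F) :=
  LinearMap.pi fun i => Polynomial.leval (α i)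

/-- The data defining a twisted Reed--Solomon code of length `n` and dimension `k`
with `ℓ` twists over `F`. -/
structure TwistedRSParams (F : Type*) [Field F] (n k ℓ : ℕ) where
  k_pos : 0 < k
  k_lt_n : k < n
  ℓ_pos : 0 < ℓ
  /-- evaluation points -/
  α : Fin n → F
  α_injective : Function.Injective α
  /-- twist vector, with entries in `{1, …, n - k}` -/
  t : Fin ℓ → ℕ
  one_le_t : ∀ j, 1 ≤ t j
  t_le : ∀ j, t j ≤ n - k
  /-- hook vector, with entries in `{0, …, k - 1}` -/
  h : Fin ℓ → Fin k
  /-- coefficient vector -/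
  η : Fin ℓ → F
  ht_injective : Function.Injective fun j => (h j, t j)

namespace TwistedRSParams

/-- The space of twisted polynomials
`∑_{i < k} f_i X^i + ∑_j η_j f_{h_j} X^{k - 1 + t_j}`. -/
def twistedPolys {F : Type*} [Field F] {n k ℓ : ℕ} (D : TwistedRSParams F n k ℓ) :
    Submodule F F[X] where
  carrier := {p | ∃ f : Fin k → F,
    p = ∑ i : Fin k, C (f i) * X ^ (i : ℕ) + ∑ j : Fin ℓ, C (D.η j * f (D.h j)) * X ^ (k - 1 + D.t j)}
  zero_mem' := ⟨0, by simp⟩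
  add_mem' := by
    rintro _ _ ⟨f, rfl⟩ ⟨g, rfl⟩
    refine ⟨f + g, ?_⟩
    simp only [Pi.add_apply, mul_add, map_add, add_mul, Finset.sum_add_distrib]
    ring
  smul_mem' := by
    rintro c _ ⟨f, rfl⟩
    refine ⟨c • f, ?_⟩
    simp only [Pi.smul_apply, smul_eq_mul, Polynomial.smul_eq_C_mul, mul_add, Finset.mul_sum,
      map_mul]
    congr 1 <;> refine Finset.sum_congr rfl fun i _ => ?_ <;> ring

/-- The twisted Reed--Solomon code. -/
def code {F : Type*} [Field F] {n k ℓ : ℕ} (D : TwistedRSParams F n k ℓ) :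
    Submodule F (Fin n → F) :=
  D.twistedPolys.map (evalMap D.α)

/-- One twist, with `t = 1` and `h = 0`. -/
def IsTwistOneHookZero {F : Type*} [Field F] {n k : ℕ} (D : TwistedRSParams F n k 1) : Prop :=
  D.t 0 = 1 ∧ (D.h 0 : ℕ) = 0

/-- The `(∗)`-twisted codes: `t = 1`, `h = 0`, and for some proper subgroup `G` of the
multiplicative group of `F`, all evaluation points lie in `G ∪ {0}` and
`(-1)^k η⁻¹` is a nonzero element outside `G`. -/
def IsStarTwisted {F : Type*} [Field F] {n k : ℕ} (D : TwistedRSParams F n k 1) : Prop :=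
  D.IsTwistOneHookZero ∧
    ∃ G : Subgroup Fˣ, G ≠ ⊤ ∧ (∀ i, D.α i = 0 ∨ ∃ g ∈ G, D.α i = (g : F)) ∧
      ∃ u : Fˣ, u ∉ G ∧ (u : F) = (-1) ^ k * (D.η 0)⁻¹

end TwistedRSParams

end

/-! A twisted polynomial has degree at most `k`, so one with `k` zeros at evaluation points is a
multiple of `∏ (X - α_i)`; comparing its constant and top coefficients shows that the code fails to
be MDS exactly when some `k` evaluation points have product `(-1)^k η⁻¹`. If the points lie in `G ∪
{0}` and that element lies outside `G`, this cannot happen; taking `G` to be the squares gives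
length `(q+1)/2`.

For the upper bound, more than `(q+1)/2` points include more than `m = (q-1)/2` nonzero ones, and
every unit must be shown to be a product of `k` distinct ones (`mem_subsetProds_of_half_lt_card`).
Split `m + 1` of them into squares and nonsquares, take `j` factors from the nonsquares with `j` of
the right parity, and apply pigeonhole in a coset of the squares. This works because a set in a
cyclic group has at least as many `j`-fold products of distinct elements as it has elements
(`card_le_card_subsetProds`). -/

lemma card_subgroup_eq_card_filter {G : Type*} [CommGroup G] [Fintype G] (K : Subgroup G) [DecidablePred (· ∈ K)] :
    Nat.card K = (Finset.univ.filter (· ∈ K)).card := by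
  rw [Nat.card_eq_fintype_card]
  exact Fintype.card_subtype (· ∈ K)

/-! ### Products of distinct elements in a finite cyclic group -/

/-- The products of `j` distinct elements of `X`. -/
def subsetProds {G : Type*} [CommGroup G] [DecidableEq G] (j : ℕ) (X : Finset G) : Finset G :=
  (X.powersetCard j).image fun T => ∏ x ∈ T, x

section SubsetProds

variable {G : Type*} [CommGroup G] [DecidableEq G]

lemma mem_subsetProds {j : ℕ} {X : Finset G} {g : G} :
    g ∈ subsetProds j X ↔ ∃ T ⊆ X, T.card = j ∧ ∏ x ∈ T, x = g := by
  simp [subsetProds, Finset.mem_powersetCard, and_assoc]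

lemma subsetProds_mono (j : ℕ) {X Y : Finset G} (h : X ⊆ Y) :
    subsetProds j X ⊆ subsetProds j Y := by
  intro g hg
  obtain ⟨T, hT, hc, rfl⟩ := mem_subsetProds.1 hg
  exact mem_subsetProds.2 ⟨T, hT.trans h, hc, rfl⟩

lemma subsetProds_one (X : Finset G) : subsetProds 1 X = X := by
  ext g
  rw [mem_subsetProds]
  constructor
  · rintro ⟨T, hT, hc, rfl⟩
    obtain ⟨a, rfl⟩ := Finset.card_eq_one.1 hc
    simpa using hT
  · intro hg
    exact ⟨{g}, by simpa using hg, by simp, by simp⟩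

lemma subsetProds_card_pos {j : ℕ} {X : Finset G} (h : j ≤ X.card) :
    1 ≤ (subsetProds j X).card := by
  obtain ⟨T, hT, hc⟩ := Finset.exists_subset_card_eq h
  exact Finset.card_pos.2 ⟨_, mem_subsetProds.2 ⟨T, hT, hc, rfl⟩⟩

lemma mul_mem_subsetProds {i j : ℕ} {X Y Z : Finset G} (hXZ : X ⊆ Z) (hYZ : Y ⊆ Z)
    (hXY : Disjoint X Y) {a b : G} (ha : a ∈ subsetProds i X) (hb : b ∈ subsetProds j Y) :
    a * b ∈ subsetProds (i + j) Z := by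
  obtain ⟨T, hT, rfl, rfl⟩ := mem_subsetProds.1 ha
  obtain ⟨U, hU, rfl, rfl⟩ := mem_subsetProds.1 hb
  have hTU : Disjoint T U := Finset.disjoint_of_subset_left hT (Finset.disjoint_of_subset_right hU hXY)
  exact mem_subsetProds.2 ⟨T ∪ U, Finset.union_subset (hT.trans hXZ) (hU.trans hYZ),
    Finset.card_union_of_disjoint hTU, Finset.prod_union hTU⟩

lemma div_mem_subsetProds {j : ℕ} {X : Finset G} {g : G} (hg : g ∈ subsetProds j X) :
    (∏ x ∈ X, x) / g ∈ subsetProds (X.card - j) X := by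
  obtain ⟨T, hT, rfl, rfl⟩ := mem_subsetProds.1 hg
  refine mem_subsetProds.2 ⟨X \ T, Finset.sdiff_subset, Finset.card_sdiff_of_subset hT, ?_⟩
  exact eq_div_of_mul_eq' (Finset.prod_sdiff hT)

/-- Complementing a subset of `X` turns its product `g` into `(∏ X) / g`, which is injective in `g`.
-/
lemma card_subsetProds_compl {j : ℕ} {X : Finset G} :
    (subsetProds j X).card ≤ (subsetProds (X.card - j) X).card :=
  Finset.card_le_card_of_injOn (fun g => (∏ x ∈ X, x) / g) (fun _ hg => div_mem_subsetProds hg)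
    (fun _ _ _ _ h => div_right_injective h)

lemma pow_mul_mem_subsetProds {j : ℕ} {X Y : Finset G} {c g : G} (hc : ∀ x ∈ X, c * x ∈ Y)
    (hg : g ∈ subsetProds j X) : c ^ j * g ∈ subsetProds j Y := by
  obtain ⟨T, hT, rfl, rfl⟩ := mem_subsetProds.1 hg
  refine mem_subsetProds.2 ⟨T.image (c * ·), ?_, ?_, ?_⟩
  · intro y hy
    obtain ⟨x, hx, rfl⟩ := Finset.mem_image.1 hy
    exact hc x (hT hx)
  · exact Finset.card_image_of_injective _ (mul_right_injective c)
  · rw [Finset.prod_image fun _ _ _ _ h => mul_right_injective c h, Finset.prod_mul_distrib,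
      Finset.prod_const]

variable [Fintype G]

/-- Each ordered pair in `S × S` is counted by exactly one quotient `d`. -/
lemma sum_card_filter_mul_mem (S : Finset G) :
    ∑ d : G, (S.filter fun s => d * s ∈ S).card = S.card * S.card := by
  simp_rw [Finset.card_filter]
  rw [Finset.sum_comm, ← smul_eq_mul, ← Finset.sum_const]
  refine Finset.sum_congr rfl fun s _ => ?_
  rw [← Finset.card_filter]
  refine Finset.card_bij (fun d _ => d * s) (by simp) (fun _ _ _ _ h => mul_left_injective s h) ?_
  intro b hb
  exact ⟨b / s, by simpa using hb, by simp⟩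

/-- If many shifts by quotients of elements of `X` nearly preserve a set with `|X| - 1` elements,
then `X` is a coset of a subgroup. -/
lemma exists_subgroup_of_card_filter {X S : Finset G} {n : ℕ} (hn : 3 ≤ n) (hX : X.card = n)
    (hS : S.card + 1 = n)
    (hXS : ∀ x ∈ X, ∀ y ∈ X, x ≠ y → n ≤ (S.filter fun s => x / y * s ∈ S).card + 2) :
    ∃ K : Subgroup G, Nat.card K = n ∧ (∀ c ∈ K, ∀ x ∈ X, c * x ∈ X) ∧
      ∀ s ∈ S, ∀ t ∈ S, t / s ∈ K := by
  set r : G → ℕ := fun d => (S.filter fun s => d * s ∈ S).card with hr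
  have hr1 : r 1 = S.card := by simp [hr]
  -- The quotients `x / y` with `y ∈ X` already use up the total `(n-1)²`: `n - 1` from `d = 1` and
  -- at least `n - 2` from each of the `n - 1` others. So no other `d` has `r d ≠ 0`, and the set `x
  -- / X` is the same for all `x ∈ X`.
  have key : ∀ x ∈ X, ∀ d : G, r d ≠ 0 → ∃ y ∈ X, d = x / y := by
    intro x hx d hd
    by_contra hcon
    push Not at hcon
    have hinj : Function.Injective fun y : G => x / y := div_right_injective
    have hdn : d ∉ X.image fun y => x / y := by
      simp only [Finset.mem_image, not_exists, not_and]
      exact fun y hy h => hcon y hy h.symm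
    have h1 : ∑ e ∈ insert d (X.image fun y => x / y), r e ≤ S.card * S.card := by
      rw [← sum_card_filter_mul_mem S]
      exact Finset.sum_le_univ_sum_of_nonneg fun _ => Nat.zero_le _
    rw [Finset.sum_insert hdn, Finset.sum_image hinj.injOn, ← Finset.add_sum_erase X _ hx,
      div_self', hr1] at h1
    have h2 : (X.erase x).card • (n - 2) ≤ ∑ y ∈ X.erase x, r (x / y) := by
      refine Finset.card_nsmul_le_sum _ _ _ fun y hy => ?_
      rw [Finset.mem_erase] at hy
      have := hXS x hx y hy.2 hy.1.symm
      simp only [hr]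
      omega
    rw [Finset.card_erase_of_mem hx, hX, smul_eq_mul] at h2
    obtain ⟨m, rfl⟩ : ∃ m, n = m + 2 := ⟨n - 2, by omega⟩
    have h3 : S.card = m + 1 := by omega
    simp only [h3, Nat.add_sub_cancel, show m + 2 - 1 = m + 1 from rfl] at h1 h2
    have : r d ≥ 1 := Nat.one_le_iff_ne_zero.2 hd
    nlinarith
  have hne : ∀ x ∈ X, ∀ y ∈ X, r (x / y) ≠ 0 := by
    intro x hx y hy
    by_cases hxy : x = y
    · rw [hxy, div_self', hr1]; omega
    · have := hXS x hx y hy hxy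
      simp only [hr]
      omega
  obtain ⟨x₀, hx₀⟩ : X.Nonempty := Finset.card_pos.1 (by omega)
  have hmul : ∀ a ∈ X, ∀ x ∈ X, x₀ / a * x ∈ X := by
    intro a ha x hx
    obtain ⟨y, hy, h⟩ := key x hx (a / x₀) (hne a ha x₀ hx₀)
    have : x₀ / a * x = y := by
      rw [← inv_div a x₀, h, inv_div, div_mul_cancel]
    rwa [this]
  have hcl : ∀ a ∈ X, ∀ b ∈ X, ∃ c ∈ X, a / b = x₀ / c := fun a ha b hb =>
    key x₀ hx₀ _ (hne a ha b hb)
  let K : Subgroup G :=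
    { carrier := {d | ∃ y ∈ X, d = x₀ / y}
      one_mem' := ⟨x₀, hx₀, by simp⟩
      inv_mem' := by
        rintro _ ⟨y, hy, rfl⟩
        rw [inv_div]
        exact hcl y hy x₀ hx₀
      mul_mem' := by
        rintro _ _ ⟨y, hy, rfl⟩ ⟨z, hz, rfl⟩
        have := hmul y hy x₀ hx₀
        rw [← mul_div_assoc]
        exact hcl _ this z hz }
  have hKmem : ∀ d, d ∈ K ↔ ∃ y ∈ X, d = x₀ / y := fun d => Iff.rfl
  refine ⟨K, ?_, ?_, ?_⟩
  · have : (K : Set G) = ((X.image fun y => x₀ / y : Finset G) : Set G) := by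
      ext d
      simp only [SetLike.mem_coe, hKmem, Finset.coe_image, Set.mem_image, eq_comm]
    rw [← SetLike.coe_sort_coe, this, Nat.card_coe_set_eq, Set.ncard_coe_finset,
      Finset.card_image_of_injective _ div_right_injective, hX]
  · rintro c hc x hx
    obtain ⟨y, hy, rfl⟩ := (hKmem c).1 hc
    exact hmul y hy x hx
  · intro s hs t ht
    refine (hKmem _).2 (key x₀ hx₀ _ ?_)
    refine (Finset.card_pos.2 ⟨s, ?_⟩).ne'
    simp [hs, ht]

variable [IsCyclic G]

/-- In a finite cyclic group, a set `X` has at least `|X|` products of `j` distinct elements. -/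
theorem card_le_card_subsetProds (X : Finset G) (j : ℕ) (hj : 1 ≤ j) (hjX : j + 1 ≤ X.card) :
    X.card ≤ (subsetProds j X).card := by
  induction hn : X.card using Nat.strong_induction_on generalizing X j with
  | _ n ih =>
  rcases Nat.eq_or_lt_of_le hj with rfl | hj2
  · rw [subsetProds_one, hn]
  rcases Nat.eq_or_lt_of_le hjX with hjn | hjn
  · have := card_subsetProds_compl (j := 1) (X := X)
    rwa [subsetProds_one, ← hjn, Nat.add_sub_cancel, hjn, hn] at this
  by_contra hcon
  push Not at hcon
  -- Induction on `X` minus a point gives at least `n - 1` products, and a counterexample has fewer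
  -- than `n`.
  have hS : (subsetProds j X).card + 1 = n := by
    obtain ⟨x, hx⟩ : X.Nonempty := Finset.card_pos.1 (by omega)
    have hc := Finset.card_erase_of_mem hx
    have := ih (n - 1) (by omega) (X.erase x) j hj (by omega) (by omega)
    have := this.trans (Finset.card_le_card (subsetProds_mono j (X.erase_subset x)))
    omega
  obtain ⟨K, hK, hKX, hKS⟩ := exists_subgroup_of_card_filter (by omega) hn hS (by
    intro x hx y hy hxy
    have hy' : y ∈ X.erase x := Finset.mem_erase.2 ⟨hxy.symm, hy⟩
    have hc := Finset.card_erase_of_mem hx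
    have hc' := Finset.card_erase_of_mem hy'
    have h := ih (n - 2) (by omega) ((X.erase x).erase y) (j - 1) (by omega) (by omega) (by omega)
    -- Exchanging the factor `y` for `x` sends `y * p` to `x * p`, both in `subsetProds j X` when
    -- `p` uses neither `x` nor `y`.
    have hle : (subsetProds (j - 1) ((X.erase x).erase y)).card ≤
        ((subsetProds j X).filter fun s => x / y * s ∈ subsetProds j X).card := by
      have hmem : ∀ z ∈ X, z ∉ (X.erase x).erase y →
          ∀ p ∈ subsetProds (j - 1) ((X.erase x).erase y), z * p ∈ subsetProds j X := by
        intro z hz hzn p hp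
        have := mul_mem_subsetProds (i := 1) (X := {z}) (Z := X) (by simpa using hz)
          ((Finset.erase_subset _ _).trans (Finset.erase_subset _ _)) (by simpa using hzn)
          (a := z) (by rw [subsetProds_one]; simp) hp
        rwa [show 1 + (j - 1) = j by omega] at this
      refine Finset.card_le_card_of_injOn (fun p => y * p) (fun p hp => ?_)
        (fun _ _ _ _ h => mul_right_injective y h)
      simp only [Finset.coe_filter, Set.mem_ofPred_eq]
      refine ⟨hmem y hy (by simp) p hp, ?_⟩
      rw [← mul_assoc, div_mul_cancel]
      exact hmem x hx (by simp) p hp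
    omega)
  obtain ⟨s, hs⟩ : (subsetProds j X).Nonempty := Finset.card_pos.1 (by omega)
  classical
  set C : Finset G := Finset.univ.filter fun t => t / s ∈ K with hC
  have hCcard : C.card = n := by
    rw [← hK, card_subgroup_eq_card_filter]
    refine Finset.card_bij (fun t _ => t / s) (by simp [hC])
      (fun _ _ _ _ h => div_left_injective h) ?_
    intro b hb
    exact ⟨b * s, by simpa [hC] using hb, by simp⟩
  have hSC : subsetProds j X ⊆ C := fun t ht => by simpa [hC] using hKS s hs t ht
  -- The products fill a coset of `K` except for one element `p`. As `K` preserves `X`,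
  -- multiplication by `c ^ j` preserves the products, hence fixes `p`. Then all `n` elements of `K`
  -- satisfy `c ^ j = 1`, which has at most `j < n` solutions in a cyclic group.
  obtain ⟨p, hp⟩ : ∃ p, C \ subsetProds j X = {p} :=
    Finset.card_eq_one.1 (by rw [Finset.card_sdiff_of_subset hSC]; omega)
  have hpm : p ∈ C \ subsetProds j X := by rw [hp]; simp
  rw [Finset.mem_sdiff] at hpm
  have hpow : ∀ c ∈ K, c ^ j = 1 := by
    intro c hc
    have : c ^ j * p ∈ C \ subsetProds j X := by
      rw [Finset.mem_sdiff]
      refine ⟨?_, fun hmem => hpm.2 ?_⟩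
      · have h1 := hpm.1
        simp only [hC, Finset.mem_filter, Finset.mem_univ, true_and] at h1 ⊢
        rw [mul_div_assoc]
        exact K.mul_mem (K.pow_mem hc j) h1
      · have := pow_mul_mem_subsetProds (hKX c⁻¹ (K.inv_mem hc)) hmem
        rwa [inv_pow, inv_mul_cancel_left] at this
    rw [hp, Finset.mem_singleton] at this
    exact mul_eq_right.1 this
  have hle := IsCyclic.card_pow_eq_one_le (α := G) (n := j) (by omega)
  have : Nat.card K ≤ (Finset.univ.filter fun a : G => a ^ j = 1).card := by
    rw [card_subgroup_eq_card_filter]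
    refine Finset.card_le_card fun c hc => ?_
    simpa using hpow c (by simpa using hc)
  omega

end SubsetProds

/-! ### Pigeonhole across a subgroup of index two -/

section IndexTwo

variable {G : Type*} [CommGroup G] [DecidableEq G] [Fintype G] (H : Subgroup G)

/-- If `A` and `B` are subsets of a subgroup whose sizes add up to more than its order, then any
element of the subgroup is a product of an element of `A` and one of `B`, in at least
`|A| + |B| - |H|` ways. -/
lemma card_filter_div_mem {A B : Finset G} (hA : ∀ a ∈ A, a ∈ H) {g : G}
    (hB : ∀ b ∈ B, g / b ∈ H) :
    A.card + B.card ≤ (A.filter fun a => g / a ∈ B).card + Nat.card H := by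
  classical
  have hB' : (B.image fun b => g / b).card = B.card :=
    Finset.card_image_of_injective _ div_right_injective
  have hsub : A ∪ (B.image fun b => g / b) ⊆ Finset.univ.filter (· ∈ H) := by
    intro x hx
    simp only [Finset.mem_union, Finset.mem_image] at hx
    rcases hx with hx | ⟨b, hb, rfl⟩
    · simpa using hA x hx
    · simpa using hB b hb
  have hint : A ∩ (B.image fun b => g / b) = A.filter fun a => g / a ∈ B := by
    ext a
    simp only [Finset.mem_inter, Finset.mem_image, Finset.mem_filter, and_congr_right_iff]
    intro _
    constructor
    · rintro ⟨b, hb, rfl⟩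
      simpa using hb
    · exact fun h => ⟨_, h, by simp⟩
  have := Finset.card_le_card hsub
  rw [← card_subgroup_eq_card_filter] at this
  have h2 := Finset.card_union_add_card_inter A (B.image fun b => g / b)
  rw [hint, hB'] at h2
  omega

lemma mul_mem_of_card_lt {A B : Finset G} (hA : ∀ a ∈ A, a ∈ H) {g : G}
    (hB : ∀ b ∈ B, g / b ∈ H) (hAB : Nat.card H < A.card + B.card) :
    ∃ a ∈ A, ∃ b ∈ B, a * b = g := by
  have := card_filter_div_mem H hA hB
  obtain ⟨a, ha⟩ : (A.filter fun a => g / a ∈ B).Nonempty := Finset.card_pos.1 (by omega)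
  rw [Finset.mem_filter] at ha
  exact ⟨a, ha.1, _, ha.2, by simp⟩

lemma card_sq_eq_le_two [IsCyclic G] (g : G) :
    (Finset.univ.filter fun a : G => a * a = g).card ≤ 2 := by
  rcases (Finset.univ.filter fun a : G => a * a = g).eq_empty_or_nonempty with h | ⟨b, hb⟩
  · simp [h]
  · rw [Finset.mem_filter] at hb
    refine le_trans ?_ (IsCyclic.card_pow_eq_one_le (α := G) (n := 2) (by norm_num))
    refine Finset.card_le_card_of_injOn (fun a => a / b) (fun a ha => ?_)
      (fun _ _ _ _ h => div_left_injective h)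
    simp only [Finset.coe_filter, Finset.mem_univ, true_and, Set.mem_ofPred_eq] at ha ⊢
    rw [div_pow, sq, sq, ha, hb.2, div_self']

/-- In a subgroup of a cyclic group, every element is a product of `j` distinct elements
avoiding a given one. -/
lemma mem_subsetProds_of_card_add_one [IsCyclic G] {X : Finset G} (hX : ∀ x ∈ X, x ∈ H)
    (hc : X.card + 1 = Nat.card H) {j : ℕ} (hj : 2 ≤ j) (hjX : j + 2 ≤ X.card) {g : G}
    (hg : g ∈ H) : g ∈ subsetProds j X := by
  have main : ∀ i, 2 ≤ i → i + 2 ≤ X.card → 2 * i ≤ X.card → ∀ g ∈ H, g ∈ subsetProds i X := by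
    intro i hi hiX hi2 g hg
    obtain ⟨U, hU, hUc⟩ := Finset.exists_subset_card_eq (show i - 2 ≤ X.card by omega)
    have hR := Finset.card_sdiff_of_subset hU
    have hUH : ∏ x ∈ U, x ∈ H := H.prod_mem fun x hx => hX x (hU hx)
    set e := g / ∏ x ∈ U, x with he
    have heH : e ∈ H := H.div_mem hg hUH
    have hRX : ∀ a ∈ X \ U, a ∈ H := fun a ha => hX a (Finset.mem_sdiff.1 ha).1
    have h1 := card_filter_div_mem H (A := X \ U) (B := X \ U) (g := e) hRX
      fun b hb => H.div_mem heH (hRX b hb)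
    have h2 := card_sq_eq_le_two e
    -- With `i - 2` factors fixed, at least `2 |X \ U| - |H| ≥ 3` elements `a` have both `a` and `e
    -- / a` available, while at most two satisfy `a * a = e`. So some pair `z`, `e / z` is distinct.
    obtain ⟨z, hz, hz2⟩ := Finset.exists_mem_notMem_of_card_lt_card
      (s := Finset.univ.filter fun a : G => a * a = e)
      (t := (X \ U).filter fun a => e / a ∈ X \ U) (by omega)
    simp only [Finset.mem_filter, Finset.mem_univ, true_and, Finset.mem_sdiff] at hz hz2
    have hne : z ≠ e / z := fun h => hz2 (by nth_rewrite 2 [h]; simp)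
    have hzU : Disjoint ({z, e / z} : Finset G) U := by
      simp [hz.1.2, hz.2.2]
    refine mem_subsetProds.2 ⟨{z, e / z} ∪ U, ?_, ?_, ?_⟩
    · refine Finset.union_subset ?_ hU
      intro a ha
      simp only [Finset.mem_insert, Finset.mem_singleton] at ha
      rcases ha with rfl | rfl
      · exact hz.1.1
      · exact hz.2.1
    · rw [Finset.card_union_of_disjoint hzU, Finset.card_pair hne]
      omega
    · rw [Finset.prod_union hzU, Finset.prod_pair hne, mul_div_cancel, he, div_mul_cancel]
  rcases le_total (2 * j) X.card with h | h
  · exact main j hj hjX h g hg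
  -- Large `j` reduces to the complementary size `X.card - j`.
  · have hX' : ∏ x ∈ X, x ∈ H := H.prod_mem hX
    have := div_mem_subsetProds (main (X.card - j) (by omega) (by omega) (by omega) _
      (H.div_mem hX' hg))
    rwa [div_div_cancel, show X.card - (X.card - j) = j by omega] at this

lemma prod_mem_iff_even_card (hH : H.index = 2) {T : Finset G} (hT : ∀ x ∈ T, x ∉ H) :
    ∏ x ∈ T, x ∈ H ↔ Even T.card := by
  induction T using Finset.induction_on with
  | empty => simp
  | insert a s ha ih =>
    rw [Finset.prod_insert ha, Subgroup.mul_mem_iff_of_index_two hH, Finset.card_insert_of_notMem ha,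
      ih fun x hx => hT x (Finset.mem_insert_of_mem hx), Nat.even_add_one]
    have := hT a (Finset.mem_insert_self _ _)
    tauto

/-- The parity condition puts `g / b` in `H` for every `j`-fold product `b` from `Y`, so pigeonhole
takes place inside `H`. -/
lemma mem_subsetProds_of_card_lt (hH : H.index = 2) {X Y Z : Finset G} (hXZ : X ⊆ Z) (hYZ : Y ⊆ Z)
    (hX : ∀ x ∈ X, x ∈ H) (hY : ∀ y ∈ Y, y ∉ H) {i j : ℕ} {g : G} (hg : g ∈ H ↔ Even j)
    (hc : Nat.card H < (subsetProds i X).card + (subsetProds j Y).card) :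
    g ∈ subsetProds (i + j) Z := by
  have hdisj : Disjoint X Y := Finset.disjoint_left.2 fun x hx hy => hY x hy (hX x hx)
  obtain ⟨a, ha, b, hb, rfl⟩ := mul_mem_of_card_lt H (A := subsetProds i X) (B := subsetProds j Y)
    (g := g) (fun a ha => by
      obtain ⟨T, hT, -, rfl⟩ := mem_subsetProds.1 ha
      exact H.prod_mem fun x hx => hX x (hT hx)) (fun b hb => by
      obtain ⟨T, hT, hTc, rfl⟩ := mem_subsetProds.1 hb
      rw [div_eq_mul_inv, Subgroup.mul_mem_iff_of_index_two hH, inv_mem_iff,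
        prod_mem_iff_even_card H hH fun x hx => hY x (hT hx), hTc, hg]) hc
  exact mul_mem_subsetProds hXZ hYZ hdisj ha hb

/-- If `|Y| ≥ 3`, two consecutive values of `j` are admissible, one of which has the right parity.
If `|Y| ≤ 2`, then `X` is `H` with at most one element missing, and `j ∈ {0, 1, 2}` suffices. -/
lemma subsetProds_eq_univ_aux [IsCyclic G] (hH : H.index = 2) (h6 : 6 ≤ Nat.card H) {X Y Z : Finset G}
    (hXZ : X ⊆ Z) (hYZ : Y ⊆ Z) (hX : ∀ x ∈ X, x ∈ H) (hY : ∀ y ∈ Y, y ∉ H)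
    (hc : X.card + Y.card = Nat.card H + 1) (hYX : Y.card ≤ X.card) {k : ℕ} (hk : 3 ≤ k)
    (hkH : k + 2 ≤ Nat.card H) (g : G) : g ∈ subsetProds k Z := by
  classical
  have hXH : X.card ≤ Nat.card H := by
    rw [card_subgroup_eq_card_filter]
    exact Finset.card_le_card fun x hx => by simpa using hX x hx
  have fin : ∀ j ≤ k, (g ∈ H ↔ Even j) →
      Nat.card H < (subsetProds (k - j) X).card + (subsetProds j Y).card → g ∈ subsetProds k Z := by
    intro j hj hg h
    have := mem_subsetProds_of_card_lt H hH hXZ hYZ hX hY hg h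
    rwa [Nat.sub_add_cancel hj] at this
  have hXi : ∀ i, 1 ≤ i → i + 1 ≤ X.card → X.card ≤ (subsetProds i X).card :=
    fun i => card_le_card_subsetProds X i
  have hYj : ∀ j, 1 ≤ j → j + 1 ≤ Y.card → Y.card ≤ (subsetProds j Y).card :=
    fun j => card_le_card_subsetProds Y j
  have hYp : ∀ j ≤ Y.card, 1 ≤ (subsetProds j Y).card := fun j => subsetProds_card_pos
  have hfull : ∀ i, 2 ≤ i → i + 2 ≤ X.card → X.card + 1 = Nat.card H →
      Nat.card H ≤ (subsetProds i X).card := by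
    intro i hi hiX h
    rw [card_subgroup_eq_card_filter]
    refine Finset.card_le_card fun x hx => ?_
    exact mem_subsetProds_of_card_add_one H hX h hi hiX (by simpa using hx)
  rcases Nat.lt_or_ge Y.card 3 with hb | hb
  · by_cases hg : g ∈ H
    · obtain hb | hb : Y.card = 1 ∨ Y.card = 2 := by omega
      · refine fin 0 (by omega) (by simpa using hg) ?_
        have := hXi (k - 0) (by omega) (by omega)
        have := hYp 0 (by omega)
        omega
      · rcases Nat.lt_or_ge (k + 2) (Nat.card H) with hk' | hk'
        · refine fin 0 (by omega) (by simpa using hg) ?_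
          have := hfull (k - 0) (by omega) (by omega) (by omega)
          have := hYp 0 (by omega)
          omega
        -- Here `k = |H| - 2`, and `6 ≤ |H|` ensures `2 ≤ k - 2`.
        · refine fin 2 (by omega) (by simpa using hg) ?_
          have := hfull (k - 2) (by omega) (by omega) (by omega)
          have := hYp 2 (by omega)
          omega
    · refine fin 1 (by omega) (by simpa using hg) ?_
      have h1 := hXi (k - 1) (by omega) (by omega)
      obtain hb | hb : Y.card = 1 ∨ Y.card = 2 := by omega
      · have := hYp 1 (by omega)
        omega
      · have := hYj 1 (by omega) (by omega)
        omega
  · obtain ⟨j, hj1, hj2, hj3, hj4, hg⟩ : ∃ j, 1 ≤ j ∧ j + 1 ≤ Y.card ∧ j + 1 ≤ k ∧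
        k + 1 ≤ X.card + j ∧ (g ∈ H ↔ Even j) := by
      -- `l` is the least positive value with `k - l < |X|`; the bound `k + 2 ≤ |H|` leaves room for
      -- `l + 1` below `|Y|`.
      have : ∃ l, 1 ≤ l ∧ l + 2 ≤ Y.card ∧ l + 2 ≤ k ∧ k + 1 ≤ X.card + l := by
        rcases Nat.le_total k X.card with h | h
        · exact ⟨1, by omega⟩
        · exact ⟨k + 1 - X.card, by omega⟩
      obtain ⟨l, h1, h2, h3, h4⟩ := this
      by_cases hl : g ∈ H ↔ Even l
      · exact ⟨l, h1, by omega, by omega, h4, hl⟩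
      · refine ⟨l + 1, by omega, by omega, by omega, by omega, ?_⟩
        rw [Nat.even_add_one]
        tauto
    refine fin j (by omega) hg ?_
    have := hXi (k - j) (by omega) (by omega)
    have := hYj j hj1 hj2
    omega

/-- In a finite cyclic group of even order `2m ≥ 12`, every element is a product of `k` distinct
elements of any given set with more than `m` elements, for `3 ≤ k ≤ m - 2`. -/
theorem mem_subsetProds_of_half_lt_card [IsCyclic G] (hH : H.index = 2) (h6 : 6 ≤ Nat.card H)
    {S : Finset G} (hS : Nat.card H < S.card) {k : ℕ} (hk : 3 ≤ k) (hkH : k + 2 ≤ Nat.card H)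
    (g : G) : g ∈ subsetProds k S := by
  classical
  obtain ⟨Z, hZS, hZ⟩ := Finset.exists_subset_card_eq (show Nat.card H + 1 ≤ S.card from hS)
  refine subsetProds_mono k hZS ?_
  have hsplit := Finset.card_filter_add_card_filter_not (s := Z) (· ∈ H)
  rcases le_total (Z.filter (· ∉ H)).card (Z.filter (· ∈ H)).card with h | h
  · exact subsetProds_eq_univ_aux H hH h6 (X := Z.filter (· ∈ H)) (Y := Z.filter (· ∉ H))
      (Finset.filter_subset _ _) (Finset.filter_subset _ _) (by simp) (by simp)
      (by omega) h hk hkH g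
  -- Translation by `t ∉ H` swaps the two cosets and multiplies every `k`-fold product by `t ^ k`.
  · obtain ⟨t, ht⟩ : ∃ t, t ∉ H := by
      by_contra hcon
      push Not at hcon
      rw [(Subgroup.eq_top_iff' H).2 hcon, Subgroup.index_top] at hH
      omega
    have hti : t⁻¹ ∉ H := fun h => ht (by simpa using h)
    have hinj : Function.Injective (t * ·) := mul_right_injective t
    have hc1 := Finset.card_image_of_injective (Z.filter (· ∉ H)) hinj
    have hc2 := Finset.card_image_of_injective (Z.filter (· ∈ H)) hinj
    have := subsetProds_eq_univ_aux H hH h6 (X := (Z.filter (· ∉ H)).image (t * ·))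
      (Y := (Z.filter (· ∈ H)).image (t * ·)) (Z := Z.image (t * ·))
      (Finset.image_subset_image (Finset.filter_subset _ _))
      (Finset.image_subset_image (Finset.filter_subset _ _))
      (by
        simp only [Finset.mem_image, Finset.mem_filter]
        rintro _ ⟨a, ⟨-, ha⟩, rfl⟩
        rw [Subgroup.mul_mem_iff_of_index_two hH]
        tauto)
      (by
        simp only [Finset.mem_image, Finset.mem_filter]
        rintro _ ⟨a, ⟨-, ha⟩, rfl⟩
        rw [Subgroup.mul_mem_iff_of_index_two hH]
        tauto)
      (by omega) (by omega) hk hkH (t ^ k * g)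
    have := pow_mul_mem_subsetProds (c := t⁻¹) (Y := Z) (by
      simp only [Finset.mem_image]
      rintro _ ⟨a, ha, rfl⟩
      simpa using ha) this
    rwa [inv_pow, inv_mul_cancel_left] at this

end IndexTwo

/-! ### The MDS property as a condition on products of evaluation points -/

namespace TwistedRSParams

section Code

variable {F : Type*} [Field F] {n k ℓ : ℕ}

/-- The parametrization of the twisted polynomials by their first `k` coefficients. -/
noncomputable def twistedPoly (D : TwistedRSParams F n k ℓ) : (Fin k → F) →ₗ[F] F[X] where
  toFun f := ∑ i : Fin k, C (f i) * X ^ (i : ℕ) +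
    ∑ j : Fin ℓ, C (D.η j * f (D.h j)) * X ^ (k - 1 + D.t j)
  map_add' f g := by
    simp only [Pi.add_apply, mul_add, map_add, add_mul, Finset.sum_add_distrib]
    ring
  map_smul' c f := by
    simp only [Pi.smul_apply, smul_eq_mul, Polynomial.smul_eq_C_mul, mul_add, Finset.mul_sum,
      map_mul, RingHom.id_apply]
    congr 1 <;> refine Finset.sum_congr rfl fun i _ => ?_ <;> ring

lemma code_eq_range (D : TwistedRSParams F n k ℓ) :
    D.code = LinearMap.range (evalMap D.α ∘ₗ D.twistedPoly) := by
  rw [LinearMap.range_comp, code]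
  congr 1
  ext p
  exact exists_congr fun f => eq_comm

lemma mem_code_iff (D : TwistedRSParams F n k ℓ) (x : Fin n → F) :
    x ∈ D.code ↔ ∃ f, ∀ i, (D.twistedPoly f).eval (D.α i) = x i := by
  rw [code_eq_range, LinearMap.mem_range]
  exact exists_congr fun f => funext_iff

lemma finrank_code_le (D : TwistedRSParams F n k ℓ) : Module.finrank F D.code ≤ k := by
  rw [code_eq_range]
  simpa using LinearMap.finrank_range_le (evalMap D.α ∘ₗ D.twistedPoly)

end Code

section OneTwist

variable {F : Type*} [Field F] {n k : ℕ} {D : TwistedRSParams F n k 1}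

lemma IsTwistOneHookZero.twistedPoly_eq (hD : D.IsTwistOneHookZero) (f : Fin k → F) :
    D.twistedPoly f = ∑ i : Fin k, C (f i) * X ^ (i : ℕ) + C (D.η 0 * f ⟨0, D.k_pos⟩) * X ^ k := by
  have h0 : D.h 0 = ⟨0, D.k_pos⟩ := Fin.ext hD.2
  have := D.k_pos
  simp only [twistedPoly, LinearMap.coe_mk, AddHom.coe_mk, Fin.sum_univ_one, hD.1, h0]
  rw [Nat.sub_add_cancel this]

lemma IsTwistOneHookZero.coeff_of_lt (hD : D.IsTwistOneHookZero) (f : Fin k → F) (i : Fin k) :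
    (D.twistedPoly f).coeff i = f i := by
  rw [hD.twistedPoly_eq]
  simp only [coeff_add, finsetSum_coeff, coeff_C_mul, coeff_X_pow]
  rw [if_neg i.2.ne, Finset.sum_eq_single i]
  · simp
  · intro j _ hj
    rw [if_neg fun h => hj (Fin.ext h.symm), mul_zero]
  · simp

lemma IsTwistOneHookZero.coeff_top (hD : D.IsTwistOneHookZero) (f : Fin k → F) :
    (D.twistedPoly f).coeff k = D.η 0 * f ⟨0, D.k_pos⟩ := by
  rw [hD.twistedPoly_eq]
  simp only [coeff_add, finsetSum_coeff, coeff_C_mul, coeff_X_pow]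
  rw [Finset.sum_eq_zero fun i _ => by rw [if_neg i.2.ne', mul_zero]]
  simp

lemma IsTwistOneHookZero.natDegree_le (hD : D.IsTwistOneHookZero) (f : Fin k → F) :
    (D.twistedPoly f).natDegree ≤ k := by
  rw [hD.twistedPoly_eq]
  refine natDegree_add_le_of_degree_le ?_ (natDegree_C_mul_X_pow_le _ _)
  exact natDegree_sum_le_of_forall_le _ _ fun i _ => (natDegree_C_mul_X_pow_le _ _).trans i.2.le

lemma coeff_zero_prod_X_sub_C (α : Fin n → F) (T : Finset (Fin n)) :
    (∏ i ∈ T, (X - C (α i))).coeff 0 = (-1) ^ T.card * ∏ i ∈ T, α i := by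
  rw [coeff_zero_eq_eval_zero, eval_prod, ← Finset.prod_neg]
  simp

lemma coeff_card_prod_X_sub_C (α : Fin n → F) {T : Finset (Fin n)}
    (hT : T.card = k) : (∏ i ∈ T, (X - C (α i))).coeff k = 1 := by
  have := (monic_prod_X_sub_C α T).coeff_natDegree
  rwa [natDegree_finsetProd_X_sub_C_eq_card, hT] at this

/-- A nonzero twisted polynomial with `k` zeros forces a relation between these zeros. -/
lemma IsTwistOneHookZero.prod_eq_one_of_eval_eq_zero (hD : D.IsTwistOneHookZero) {f : Fin k → F}
    (hf : f ≠ 0) {T : Finset (Fin n)} (hT : T.card = k)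
    (hz : ∀ i ∈ T, (D.twistedPoly f).eval (D.α i) = 0) :
    D.η 0 * ((-1) ^ k * ∏ i ∈ T, D.α i) = 1 := by
  have hp0 : D.twistedPoly f ≠ 0 := by
    intro h
    refine hf (funext fun i => ?_)
    rw [← hD.coeff_of_lt f i, h, coeff_zero, Pi.zero_apply]
  have hdvd : ∏ i ∈ T, (X - C (D.α i)) ∣ D.twistedPoly f := by
    refine Finset.prod_dvd_of_coprime ?_ fun i hi => dvd_iff_isRoot.2 (hz i hi)
    intro i _ j _ hij
    exact pairwise_coprime_X_sub_C D.α_injective hij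
  obtain ⟨r, hr⟩ := hdvd
  have hm := monic_prod_X_sub_C D.α T
  have hr0 : r ≠ 0 := by
    rintro rfl
    exact hp0 (by rw [hr, mul_zero])
  have hdeg := hD.natDegree_le f
  rw [hr, hm.natDegree_mul' hr0, natDegree_finsetProd_X_sub_C_eq_card, hT] at hdeg
  -- The product of the linear factors already has degree `k`, so the cofactor is constant.
  obtain ⟨c, rfl⟩ : ∃ c, r = C c := ⟨_, eq_C_of_natDegree_eq_zero (by omega)⟩
  have hc : c ≠ 0 := by
    rintro rfl
    exact hr0 C_0
  have h1 := hD.coeff_top f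
  have h2 := hD.coeff_of_lt f ⟨0, D.k_pos⟩
  rw [hr, coeff_mul_C] at h1 h2
  rw [coeff_card_prod_X_sub_C _ hT] at h1
  simp only at h2
  rw [coeff_zero_prod_X_sub_C, hT] at h2
  rw [← h2] at h1
  apply mul_right_cancel₀ hc
  rw [h1]
  ring

lemma IsTwistOneHookZero.exists_twistedPoly_eq_prod (hD : D.IsTwistOneHookZero)
    {T : Finset (Fin n)} (hT : T.card = k) (h1 : D.η 0 * ((-1) ^ k * ∏ i ∈ T, D.α i) = 1) :
    ∃ f, D.twistedPoly f = ∏ i ∈ T, (X - C (D.α i)) := by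
  refine ⟨fun i => (∏ i ∈ T, (X - C (D.α i))).coeff i, ?_⟩
  ext m
  rcases lt_trichotomy m k with h | rfl | h
  · exact hD.coeff_of_lt _ ⟨m, h⟩
  · rw [hD.coeff_top]
    simp only
    rw [coeff_zero_prod_X_sub_C, hT, h1, coeff_card_prod_X_sub_C _ hT]
  · rw [coeff_eq_zero_of_natDegree_lt ((hD.natDegree_le _).trans_lt h),
      coeff_eq_zero_of_natDegree_lt]
    rwa [natDegree_finsetProd_X_sub_C_eq_card, hT]

lemma IsStarTwisted.η_ne_zero (hD : D.IsStarTwisted) : D.η 0 ≠ 0 := by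
  obtain ⟨-, G, -, -, u, -, hu⟩ := hD
  intro h
  rw [h, inv_zero, mul_zero] at hu
  exact u.ne_zero hu

variable [DecidableEq F]

/-- The product of the `k` linear factors is then itself a twisted polynomial and gives a codeword
of weight exactly `n - k`. -/
lemma IsTwistOneHookZero.not_isMDS (hD : D.IsTwistOneHookZero)
    {T : Finset (Fin n)} (hT : T.card = k) (h1 : D.η 0 * ((-1) ^ k * ∏ i ∈ T, D.α i) = 1) :
    ¬ IsMDS D.code := by
  obtain ⟨f, hf⟩ := hD.exists_twistedPoly_eq_prod hT h1
  set x : Fin n → F := fun i => (D.twistedPoly f).eval (D.α i) with hx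
  have hxi : ∀ i, x i = 0 ↔ i ∈ T := by
    intro i
    simp only [hx]
    rw [hf, eval_prod, Finset.prod_eq_zero_iff]
    simp only [eval_sub, eval_X, eval_C, sub_eq_zero, D.α_injective.eq_iff, exists_eq_right']
  have hk := D.k_lt_n
  have hd : hammingDist x 0 = n - k := by
    rw [hammingDist_zero_right, hammingNorm]
    simp only [ne_eq, hxi]
    rw [Finset.filter_not, Finset.filter_mem_eq_inter, Finset.univ_inter,
      Finset.card_sdiff_of_subset (Finset.subset_univ _), hT, Finset.card_univ, Fintype.card_fin]
  have hx0 : x ≠ 0 := by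
    rw [← hammingDist_ne_zero, hd]
    omega
  have hmin : minDist D.code ≤ n - k :=
    Nat.sInf_le ⟨x, (D.mem_code_iff x).2 ⟨f, fun _ => rfl⟩, 0, D.code.zero_mem, hx0, hd⟩
  have := D.finrank_code_le
  unfold IsMDS
  omega

lemma IsTwistOneHookZero.isMDS (hD : D.IsTwistOneHookZero)
    (h1 : ∀ T : Finset (Fin n), T.card = k → D.η 0 * ((-1) ^ k * ∏ i ∈ T, D.α i) ≠ 1) :
    IsMDS D.code := by
  have hk := D.k_lt_n
  have hkp := D.k_pos
  set L := evalMap D.α ∘ₗ D.twistedPoly with hL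
  have hLi : ∀ f i, L f i = (D.twistedPoly f).eval (D.α i) := fun _ _ => rfl
  have hzeros : ∀ f ≠ 0, (Finset.univ.filter fun i => L f i = 0).card < k := by
    intro f hf
    by_contra hcon
    push Not at hcon
    obtain ⟨T, hT, hTc⟩ := Finset.exists_subset_card_eq hcon
    refine h1 T hTc (hD.prod_eq_one_of_eval_eq_zero hf hTc fun i hi => ?_)
    simpa [hLi] using hT hi
  have hnorm : ∀ f, hammingNorm (L f) + (Finset.univ.filter fun i => L f i = 0).card = n := by
    intro f
    have := Finset.card_filter_add_card_filter_not (s := Finset.univ) fun i => L f i = 0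
    rw [Finset.card_univ, Fintype.card_fin] at this
    rw [hammingNorm, add_comm]
    exact this
  have hinj : Function.Injective L := by
    rw [← LinearMap.ker_eq_bot, LinearMap.ker_eq_bot']
    intro f hf
    by_contra hne
    have := hzeros f hne
    have := hnorm f
    rw [hf, hammingNorm_zero] at this
    rw [hf] at *
    omega
  have hfin : Module.finrank F D.code = k := by
    rw [code_eq_range, LinearMap.finrank_range_of_inj hinj, Module.finrank_fin_fun]
  have hcode : ∀ x, x ∈ D.code ↔ ∃ f, L f = x := by
    intro x
    rw [code_eq_range, LinearMap.mem_range]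
  have hlow : ∀ d ∈ {d : ℕ | ∃ x ∈ D.code, ∃ y ∈ D.code, x ≠ y ∧ hammingDist x y = d},
      n + 1 ≤ d + k := by
    rintro d ⟨x, hx, y, hy, hxy, rfl⟩
    obtain ⟨f, hf⟩ := (hcode _).1 (D.code.add_mem (D.code.neg_mem hx) hy)
    have hf0 : f ≠ 0 := by
      rintro rfl
      rw [map_zero] at hf
      exact hxy (neg_add_eq_zero.1 hf.symm)
    have h2 := hzeros f hf0
    have h3 := hnorm f
    rw [hammingDist_eq_hammingNorm, ← hf]
    omega
  -- `k - 1` linear conditions on `k` coefficients leave a nonzero word of weight at most `n - k +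
  -- 1`.
  obtain ⟨f, hf0, hf⟩ : ∃ f : Fin k → F, f ≠ 0 ∧ ∀ i : Fin (k - 1), L f (i.castLE (by omega)) = 0 := by
    let M : (Fin k → F) →ₗ[F] (Fin (k - 1) → F) := LinearMap.funLeft F F (Fin.castLE (by omega)) ∘ₗ L
    have hM : LinearMap.ker M ≠ ⊥ := LinearMap.ker_ne_bot_of_finrank_lt (by simp; omega)
    obtain ⟨f, hf, hf0⟩ := (Submodule.ne_bot_iff _).1 hM
    exact ⟨f, hf0, fun i => congrFun (LinearMap.mem_ker.1 hf) i⟩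
  have hup : minDist D.code ≤ hammingNorm (L f) := by
    refine Nat.sInf_le ⟨L f, (hcode _).2 ⟨f, rfl⟩, 0, D.code.zero_mem, ?_, hammingDist_zero_right _⟩
    intro h
    exact hf0 (hinj (h.trans (map_zero L).symm))
  have hle : k - 1 ≤ (Finset.univ.filter fun i => L f i = 0).card := by
    have := Finset.card_le_card_of_injOn (s := (Finset.univ : Finset (Fin (k - 1))))
      (t := Finset.univ.filter fun i => L f i = 0) (Fin.castLE (by omega))
      (fun i _ => by simpa using hf i) (Fin.castLE_injective _).injOn
    simpa using this
  -- Since `sInf ∅ = 0`, the lower bound applies to `minDist` only once a nonzero codeword is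
  -- exhibited.
  have hmem : minDist D.code ∈
      {d : ℕ | ∃ x ∈ D.code, ∃ y ∈ D.code, x ≠ y ∧ hammingDist x y = d} := by
    refine Nat.sInf_mem ⟨_, L f, (hcode _).2 ⟨f, rfl⟩, 0, D.code.zero_mem, ?_, rfl⟩
    intro h
    exact hf0 (hinj (h.trans (map_zero L).symm))
  have h2 := hlow _ hmem
  have h3 := hnorm f
  unfold IsMDS
  omega

/-- Every `(∗)`-twisted code is MDS. -/
lemma IsStarTwisted.isMDS (hD : D.IsStarTwisted) : IsMDS D.code := by
  have hη := IsStarTwisted.η_ne_zero hD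
  obtain ⟨h10, G, -, hα, u, hu, hue⟩ := hD
  refine h10.isMDS fun T hT h1 => hu ?_
  -- A bad `T` would have product `u ≠ 0`, making all its points elements of `G` and so `u ∈ G`.
  have hprod : ∏ i ∈ T, D.α i = u := by
    have hs : ((-1 : F) ^ k) * (-1) ^ k = 1 := by rw [← mul_pow]; simp
    rw [hue, eq_mul_inv_iff_mul_eq₀ hη]
    calc (∏ i ∈ T, D.α i) * D.η 0 = ((-1 : F) ^ k * (-1) ^ k) * ((∏ i ∈ T, D.α i) * D.η 0) := by
          rw [hs, one_mul]
      _ = (-1) ^ k * (D.η 0 * ((-1) ^ k * ∏ i ∈ T, D.α i)) := by ring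
      _ = (-1) ^ k := by rw [h1, mul_one]
  have hne : ∀ i ∈ T, D.α i ≠ 0 := Finset.prod_ne_zero_iff.1 (hprod ▸ u.ne_zero)
  have hG : ∀ i, ∃ g ∈ G, i ∈ T → D.α i = (g : F) := fun i => by
    by_cases hi : i ∈ T
    · obtain ⟨g, hg, h⟩ := (hα i).resolve_left (hne i hi)
      exact ⟨g, hg, fun _ => h⟩
    · exact ⟨1, G.one_mem, fun h => absurd h hi⟩
  choose g hg hgα using hG
  have : ∏ i ∈ T, g i = u := by
    ext
    rw [← hprod, Units.coe_prod]
    exact Finset.prod_congr rfl fun i hi => (hgα i hi).symm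
  exact this ▸ G.prod_mem fun i _ => hg i

lemma IsTwistOneHookZero.not_isMDS_of_mem_subsetProds [Fintype F] (hD : D.IsTwistOneHookZero)
    (hη : D.η 0 ≠ 0)
    (h : ∀ u : Fˣ, u ∈ subsetProds k (Finset.univ.filter fun u : Fˣ => ∃ i, D.α i = u)) :
    ¬ IsMDS D.code := by
  obtain ⟨T, hT, hTc, hTp⟩ := mem_subsetProds.1 (h ((-1) ^ k * (Units.mk0 _ hη)⁻¹))
  have hα : ∀ u ∈ T, ∃ i, D.α i = u := fun u hu => by simpa using hT hu
  have : Nonempty (Fin n) := ⟨⟨0, D.k_pos.trans D.k_lt_n⟩⟩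
  choose! f hf using hα
  have hinj : Set.InjOn f T := fun u hu v hv huv => Units.ext (by rw [← hf u hu, ← hf v hv, huv])
  refine hD.not_isMDS (T := T.image f) (by rw [Finset.card_image_of_injOn hinj, hTc]) ?_
  rw [Finset.prod_image hinj, Finset.prod_congr rfl hf, ← Units.coe_prod, hTp]
  push_cast
  rw [Units.val_mk0, mul_left_comm, mul_left_comm (D.η 0), mul_inv_cancel₀ hη, mul_one, ← mul_pow]
  simp

end OneTwist

/-! ### The extremal code and the count of nonzero evaluation points -/

section Main

variable {F : Type*} [Field F] [Fintype F]

lemma card_units_succ : Nat.card Fˣ + 1 = Fintype.card F := by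
  classical
  rw [Nat.card_eq_fintype_card, Fintype.card_units]
  have := Fintype.card_pos (α := F)
  omega

/-- In odd characteristic the squares form a subgroup of index two of the multiplicative group. -/
lemma exists_subgroup_units_index_two (hodd : Odd (Fintype.card F)) :
    ∃ H : Subgroup Fˣ, H.index = 2 ∧ 2 * Nat.card H + 1 = Fintype.card F := by
  have hc := card_units_succ (F := F)
  have hidx : (powMonoidHom 2 : Fˣ →* Fˣ).range.index = 2 := by
    rw [IsCyclic.index_powMonoidHom_range]
    refine Nat.gcd_eq_right (even_iff_two_dvd.1 ?_)
    rw [← hc, Nat.odd_add_one, Nat.not_odd_iff_even] at hodd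
    exact hodd
  refine ⟨_, hidx, ?_⟩
  rw [← hc, ← Subgroup.index_mul_card (powMonoidHom 2 : Fˣ →* Fˣ).range, hidx]

lemma exists_isStarTwisted (H : Subgroup Fˣ) (hH : H ≠ ⊤) {k : ℕ} (hk0 : 0 < k)
    (hk : k ≤ Nat.card H) : ∃ D : TwistedRSParams F (Nat.card H + 1) k 1, D.IsStarTwisted := by
  classical
  obtain ⟨u, hu⟩ : ∃ u, u ∉ H := by
    by_contra hcon
    push Not at hcon
    exact hH ((Subgroup.eq_top_iff' H).2 hcon)
  -- Adjoining `0` to `H` gives one more evaluation point at no cost.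
  set S : Finset F := insert 0 ((Finset.univ.filter (· ∈ H)).image fun u : Fˣ => (u : F)) with hS
  have hSc : S.card = Nat.card H + 1 := by
    rw [hS, Finset.card_insert_of_notMem (by simp), Finset.card_image_of_injective _ Units.val_injective,
      card_subgroup_eq_card_filter]
  let e := (S.equivFinOfCardEq hSc).symm
  refine ⟨{ k_pos := hk0, k_lt_n := by omega, ℓ_pos := one_pos, α := fun i => e i,
            α_injective := Subtype.val_injective.comp e.injective, t := fun _ => 1,
            one_le_t := fun _ => le_rfl, t_le := fun _ => by omega, h := fun _ => ⟨0, hk0⟩,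
            η := fun _ => (-1) ^ k * (u : F)⁻¹,
            ht_injective := Function.injective_of_subsingleton _ }, ⟨rfl, rfl⟩, H, hH, ?_, u, hu, ?_⟩
  · intro i
    have := (e i).2
    simp only [hS, Finset.mem_insert, Finset.mem_image, Finset.mem_filter, Finset.mem_univ,
      true_and] at this
    exact this.imp_right fun ⟨g, hg, h⟩ => ⟨g, hg, h.symm⟩
  · simp only [mul_inv, inv_inv]
    rw [← mul_assoc, ← inv_pow, ← mul_pow]
    simp

lemma card_le_card_filter_units_succ {n k ℓ : ℕ} [DecidableEq F] (D : TwistedRSParams F n k ℓ)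
    [DecidablePred fun u : Fˣ => ∃ i, D.α i = u] :
    n ≤ (Finset.univ.filter fun u : Fˣ => ∃ i, D.α i = u).card + 1 := by
  classical
  have hsub : Finset.univ.image D.α ⊆
      insert 0 ((Finset.univ.filter fun u : Fˣ => ∃ i, D.α i = u).image fun u : Fˣ => (u : F)) := by
    intro x hx
    obtain ⟨i, -, rfl⟩ := Finset.mem_image.1 hx
    by_cases h : D.α i = 0
    · simp [h]
    · refine Finset.mem_insert_of_mem (Finset.mem_image.2 ⟨Units.mk0 _ h, ?_, rfl⟩)
      simp only [Finset.mem_filter, Finset.mem_univ, true_and]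
      exact ⟨i, rfl⟩
  have := (Finset.card_le_card hsub).trans (Finset.card_insert_le _ _)
  rw [Finset.card_image_of_injective _ D.α_injective, Finset.card_univ, Fintype.card_fin,
    Finset.card_image_of_injective _ Units.val_injective] at this
  exact this

end Main

end TwistedRSParams

theorem mainTheorem9 {F : Type*} [Field F] [Fintype F] [DecidableEq F] (q k : ℕ)
    (hq : Fintype.card F = q) (hodd : Odd q) (hq13 : 13 ≤ q)
    (hk3 : 3 ≤ k) (hk : k + 2 ≤ (q - 1) / 2) :
    (∀ (n : ℕ) (D : TwistedRSParams F n k 1), (q + 1) / 2 < n →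
      D.IsTwistOneHookZero → D.η 0 ≠ 0 → ¬ IsMDS D.code) ∧
    (∃ D : TwistedRSParams F ((q + 1) / 2) k 1, D.IsStarTwisted ∧ IsMDS D.code) ∧
    IsGreatest {n : ℕ | ∃ D : TwistedRSParams F n k 1,
      D.IsTwistOneHookZero ∧ D.η 0 ≠ 0 ∧ IsMDS D.code} ((q + 1) / 2) := by
  subst hq
  obtain ⟨H, hH, hHc⟩ := TwistedRSParams.exists_subgroup_units_index_two hodd
  have hlen : (Fintype.card F + 1) / 2 = Nat.card H + 1 := by omega
  have hHtop : H ≠ ⊤ := by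
    rintro rfl
    simp at hH
  have hbound : ∀ (n : ℕ) (D : TwistedRSParams F n k 1), Nat.card H + 1 < n →
      D.IsTwistOneHookZero → D.η 0 ≠ 0 → ¬ IsMDS D.code := by
    intro n D hn hD hη
    have hcard := TwistedRSParams.card_le_card_filter_units_succ D
    exact hD.not_isMDS_of_mem_subsetProds hη fun u =>
      mem_subsetProds_of_half_lt_card H hH (by omega) (by omega) hk3 (by omega) u
  obtain ⟨D, hD⟩ := TwistedRSParams.exists_isStarTwisted H hHtop (k := k) (by omega) (by omega)
  rw [hlen]
  refine ⟨hbound, ⟨D, hD, hD.isMDS⟩, ⟨D, hD.1, hD.η_ne_zero, hD.isMDS⟩, ?_⟩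
  rintro n ⟨D', hD', hη, hmds⟩
  by_contra hn
  exact hbound n D' (not_le.1 hn) hD' hη hmds
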